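/- All posets are finite. Let $R$ be a poset with $n$ elements. A linear extension of $R$ is a bijection $\sigma\colon R\to\{1,\dots,n\}$ such that $x\le y$ implies $\sigma(x)\le\sigma(y)$. The Cartan matrix of $R$ with respect to $\sigma$ is the $n\times n$ matrix $W^{R,\sigma}$ with $W^{R,\sigma}_{i,j}=1$ if $\sigma^{-1}(i)\ge\sigma^{-1}(j)$ and $W^{R,\sigma}_{i,j}=0$ otherwise. Let $B$ be the group of invertible upper-triangular complex $n\times n$ matrices. Since $W^{R,\sigma}$ is invertible, there is a unique permutation matrix $P^{R,\sigma}$ with $W^{R,\sigma}\in BP^{R,\sigma}B$. Echelonmotion with respect to $\sigma$ is the bijection $\mathrm{Ech}_\sigma\colon R\to R$ such that $\mathrm{Ech}_\sigma(x)=y$ if and only if $P^{R,\sigma}$ has a $1$ in row $\sigma(y)$ and column $\sigma(x)$. The poset $R$ is echelon-independent if $\mathrm{Ech}_\sigma=\mathrm{Ech}_{\sigma'}$ for all linear extensions $\sigma,\sigma'$ of $R$. A lattice $L$ is semidistributive if for all $x\le y$ in $L$ the set $\{z\in L: z\wedge y=x\}$ has a maximum element and the set $\{z\in L: z\vee x=y\}$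 has a minimum element. For a cover relation $x\lessdot y$ in a semidistributive lattice $L$, let $j_{x,y}$ be the minimum element of $\{z\in L:z\vee x=y\}$, and for $w\in L$ let $\mathcal D_L(w)=\{j_{x,w}:x\lessdot w\}$ and $\mathcal U_L(w)=\{j_{w,y}:w\lessdot y\}$. Barnard's rowmotion $\mathrm{Row}_L\colon L\to L$ is the bijection characterized by $\mathcal U_L(\mathrm{Row}_L(w))=\mathcal D_L(w)$ for all $w\in L$. **Theorem.** Let $L$ be a finite lattice. 1. If $L$ is semidistributive, then there is exactly one bijection $\mathrm{Row}_L\colon L\to L$ with $\mathcal U_L(\mathrm{Row}_L(w))=\mathcal D_L(w)$ for all $w\in L$, and $\mathrm{Ech}_\sigma=\mathrm{Row}_L$ for every linear extension $\sigma$ of $L$. In particular, $L$ is echelon-independent. 2. Conversely, if $L$ is echelon-independent, then $L$ is semidistributive. -/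

import Mathlib

namespace Echelon

/-! ### Bruhat decomposition of the general linear group -/

/-- The set `B` of invertible upper-triangular complex `n × n` matrices. -/
def borel (n : ℕ) : Set (Matrix (Fin n) (Fin n) ℂ) :=
  {A | (∀ i j, j < i → A i j = 0) ∧ IsUnit A.det}

/-- The permutation matrix of `π`, with the entry `1` in row `π j` of each column `j`. -/
def permMat {n : ℕ} (π : Equiv.Perm (Fin n)) : Matrix (Fin n) (Fin n) ℂ :=
  Matrix.of fun i j => if i = π j then 1 else 0

/-- `M` lies in the double coset `B P B`, where `P` is the permutation matrix of `π`. -/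
def InBruhatCell {n : ℕ} (M : Matrix (Fin n) (Fin n) ℂ) (π : Equiv.Perm (Fin n)) : Prop :=
  ∃ A ∈ borel n, ∃ C ∈ borel n, M = A * permMat π * C

theorem borel_diag {n : ℕ} {A : Matrix (Fin n) (Fin n) ℂ} (hA : A ∈ borel n) (i : Fin n) :
    A i i ≠ 0 := by
  have h := hA.2
  rw [Matrix.det_of_isUpperTriangular (M := A) (fun i j h => hA.1 i j h), isUnit_iff_ne_zero,
    Finset.prod_ne_zero_iff] at h
  exact h i (Finset.mem_univ i)

theorem mem_borel_of_diag {n : ℕ} {A : Matrix (Fin n) (Fin n) ℂ}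
    (h : ∀ i j, j < i → A i j = 0) (hd : ∀ i, A i i ≠ 0) : A ∈ borel n := by
  refine ⟨h, ?_⟩
  rw [Matrix.det_of_isUpperTriangular (M := A) (fun i j hij => h i j hij), isUnit_iff_ne_zero,
    Finset.prod_ne_zero_iff]
  exact fun i _ => hd i

theorem borel_mul {n : ℕ} {A C : Matrix (Fin n) (Fin n) ℂ} (hA : A ∈ borel n)
    (hC : C ∈ borel n) : A * C ∈ borel n := by
  refine ⟨fun i j hij => ?_, by rw [Matrix.det_mul]; exact hA.2.mul hC.2⟩
  have hA' : A.BlockTriangular id := fun i j h => hA.1 i j h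
  have hC' : C.BlockTriangular id := fun i j h => hC.1 i j h
  exact hA'.mul hC' hij

theorem borel_inv {n : ℕ} {A : Matrix (Fin n) (Fin n) ℂ} (hA : A ∈ borel n) :
    A⁻¹ ∈ borel n := by
  have : Invertible A := A.invertibleOfIsUnitDet hA.2
  have hA' : A.BlockTriangular id := fun i j h => hA.1 i j h
  refine ⟨fun i j hij => Matrix.blockTriangular_inv_of_blockTriangular hA' hij, ?_⟩
  exact A.isUnit_nonsing_inv_det hA.2

theorem mul_permMat_apply {n : ℕ} (A : Matrix (Fin n) (Fin n) ℂ) (π : Equiv.Perm (Fin n))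
    (i j : Fin n) : (A * permMat π) i j = A i (π j) := by
  simp [Matrix.mul_apply, permMat]

theorem permMat_mul_apply {n : ℕ} (A : Matrix (Fin n) (Fin n) ℂ) (π : Equiv.Perm (Fin n))
    (i j : Fin n) : (permMat π * A) i j = A (π.symm i) j := by
  rw [Matrix.mul_apply, Finset.sum_eq_single (π.symm i)]
  · simp [permMat]
  · intro k _ hk
    have : i ≠ π k := fun h => hk (by simp [h])
    simp [permMat, this]
  · simp

theorem perm_eq_one_of_le {n : ℕ} (p : Equiv.Perm (Fin n)) (h : ∀ j, p j ≤ j) (j : Fin n) :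
    p j = j := by
  induction j using WellFoundedLT.induction with
  | ind j ih =>
    by_contra hne
    have hlt : p j < j := lt_of_le_of_ne (h j) hne
    exact hne (p.injective (ih _ hlt))

theorem bruhat_unique {n : ℕ} {M : Matrix (Fin n) (Fin n) ℂ} {π τ : Equiv.Perm (Fin n)}
    (hπ : InBruhatCell M π) (hτ : InBruhatCell M τ) : π = τ := by
  obtain ⟨A, hA, C, hC, h1⟩ := hπ
  obtain ⟨A', hA', C', hC', h2⟩ := hτ
  have key : A'⁻¹ * A * permMat π = permMat τ * (C' * C⁻¹) := by
    have e : A * permMat π * C = A' * permMat τ * C' := h1.symm.trans h2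
    have e2 := congrArg (fun X => A'⁻¹ * X * C⁻¹) e
    simp only [Matrix.mul_assoc] at e2
    rw [Matrix.mul_nonsing_inv _ hC.2, Matrix.mul_one,
      Matrix.nonsing_inv_mul_cancel_left _ _ hA'.2] at e2
    simpa only [Matrix.mul_assoc] using e2
  have hle : ∀ j, (π.trans τ.symm) j ≤ j := by
    intro j
    by_contra hlt
    have hz := (borel_mul hC' (borel_inv hC)).1 _ _ (not_le.1 hlt)
    have e := congrFun (congrFun key (π j)) j
    rw [mul_permMat_apply, permMat_mul_apply] at e
    exact borel_diag (borel_mul (borel_inv hA') hA) (π j) (e.trans hz)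
  ext1 j
  have := perm_eq_one_of_le _ hle j
  rw [Equiv.trans_apply, Equiv.symm_apply_eq] at this
  exact this

theorem bruhat_exists {n : ℕ} (M : Matrix (Fin n) (Fin n) ℂ) (hM : IsUnit M.det) :
    ∃ π, InBruhatCell M π := by
  have hinj : Function.Injective M.mulVec :=
    Matrix.mulVec_injective_iff_isUnit.2 ((Matrix.isUnit_iff_isUnit_det M).2 hM)
  -- `S j i`: a vector whose last nonzero entry is in place `j` is sent by `M` to one whose
  -- last nonzero entry is in place `i`.
  let S : Fin n → Fin n → Prop := fun j i => ∃ c : Fin n → ℂ, c j ≠ 0 ∧ (∀ k, j < k → c k = 0) ∧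
    M.mulVec c i ≠ 0 ∧ ∀ k, i < k → M.mulVec c k = 0
  have hlead : ∀ v : Fin n → ℂ, v ≠ 0 → ∃ i, v i ≠ 0 ∧ ∀ k, i < k → v k = 0 := by
    intro v hv
    obtain ⟨i₀, hi₀⟩ := Function.ne_iff.1 hv
    have hne : (Finset.univ.filter fun i => v i ≠ 0).Nonempty := ⟨i₀, by simpa using hi₀⟩
    refine ⟨_, (Finset.mem_filter.1 (Finset.max'_mem _ hne)).2, fun k hk => ?_⟩
    by_contra hvk
    exact absurd (Finset.le_max' _ k (by simpa using hvk)) (not_le.2 hk)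
  have hS : ∀ j, ∃ i, S j i ∧ ∀ i' < i, ¬ S j i' := by
    intro j
    have hne : ∃ i, S j i := by
      have hz : M.mulVec (Pi.single j 1) ≠ 0 := by
        intro h
        have h0 := hinj (h.trans (Matrix.mulVec_zero M).symm)
        have := congrFun h0 j
        simp at this
      obtain ⟨i, hi, hi'⟩ := hlead _ hz
      exact ⟨i, Pi.single j 1, by simp, fun k hk => by simp [hk.ne'], hi, hi'⟩
    obtain ⟨i, hi, hmin⟩ := WellFounded.has_min (wellFounded_lt (α := Fin n)) {i | S j i} hne
    exact ⟨i, hi, fun i' hlt hs => hmin i' hs hlt⟩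
  choose p hp hmin using hS
  choose c hc1 hc2 hc3 hc4 using hp
  have hne_of_lt : ∀ j k, j < k → p j ≠ p k := by
    intro j k hjk hpe
    set t : ℂ := M.mulVec (c k) (p k) / M.mulVec (c j) (p k) with ht
    set d : Fin n → ℂ := c k - t • c j with hd
    have hdk : d k ≠ 0 := by
      have : d k = c k k := by simp [hd, hc2 j k hjk]
      rw [this]; exact hc1 k
    have hMd : M.mulVec d = M.mulVec (c k) - t • M.mulVec (c j) := by
      rw [hd, Matrix.mulVec_sub, Matrix.mulVec_smul]
    have hz : M.mulVec d ≠ 0 := by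
      intro h
      have h0 := hinj (h.trans (Matrix.mulVec_zero M).symm)
      exact hdk (by rw [h0]; rfl)
    obtain ⟨i, hi, hi'⟩ := hlead _ hz
    have hik : i < p k := by
      by_contra hge
      apply hi
      rcases (not_lt.1 hge).eq_or_lt with h | h
      · have h3 : M.mulVec (c j) (p k) ≠ 0 := hpe ▸ hc3 j
        rw [hMd, ← h]
        simp only [Pi.sub_apply, Pi.smul_apply, smul_eq_mul, ht]
        field_simp
        ring
      · rw [hMd]
        simp [hc4 k i h, hc4 j i (hpe ▸ h)]
    refine hmin k i hik ⟨d, hdk, fun l hl => ?_, hi, hi'⟩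
    simp [hd, hc2 k l hl, hc2 j l (hjk.trans hl)]
  have hpinj : Function.Injective p := by
    intro j k h
    rcases lt_trichotomy j k with hlt | he | hlt
    · exact absurd h (hne_of_lt j k hlt)
    · exact he
    · exact absurd h.symm (hne_of_lt k j hlt)
  let π : Equiv.Perm (Fin n) := Equiv.ofBijective p (Finite.injective_iff_bijective.1 hpinj)
  have hπ : ∀ j, π j = p j := fun j => rfl
  let C : Matrix (Fin n) (Fin n) ℂ := Matrix.of fun i j => c j i
  have hC : C ∈ borel n := mem_borel_of_diag (fun i j hij => hc2 j i hij) (fun i => hc1 i)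
  let A : Matrix (Fin n) (Fin n) ℂ := Matrix.of fun i k => M.mulVec (c (π.symm k)) i
  have hA : A ∈ borel n := by
    refine mem_borel_of_diag (fun i k hik => ?_) (fun k => ?_)
    · have : p (π.symm k) = k := by rw [← hπ, Equiv.apply_symm_apply]
      exact hc4 (π.symm k) i (by rw [this]; exact hik)
    · have : p (π.symm k) = k := by rw [← hπ, Equiv.apply_symm_apply]
      have h3 := hc3 (π.symm k)
      rw [this] at h3
      exact h3
  have hMC : M * C = A * permMat π := by
    ext i j
    rw [mul_permMat_apply]
    simp [A, C, Matrix.mul_apply, Matrix.mulVec, dotProduct]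
  refine ⟨π, A, hA, C⁻¹, borel_inv hC, ?_⟩
  rw [← hMC, Matrix.mul_assoc, Matrix.mul_nonsing_inv _ hC.2, Matrix.mul_one]

/-- The permutation `π` such that the invertible matrix `M` lies in the cell `B P B`,
where `P` is the permutation matrix of `π`. -/
noncomputable def bruhatPerm {n : ℕ} (M : Matrix (Fin n) (Fin n) ℂ) (hM : IsUnit M.det) :
    Equiv.Perm (Fin n) :=
  (bruhat_exists M hM).choose

theorem inBruhatCell_iff {n : ℕ} (M : Matrix (Fin n) (Fin n) ℂ) (hM : IsUnit M.det)
    (π : Equiv.Perm (Fin n)) : InBruhatCell M π ↔ bruhatPerm M hM = π :=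
  ⟨fun h => bruhat_unique (bruhat_exists M hM).choose_spec h,
    fun h => h ▸ (bruhat_exists M hM).choose_spec⟩

/-! ### Linear extensions and echelonmotion -/

/-- A linear extension of a finite poset with `n` elements: an order-preserving bijection onto
the chain `Fin n`. -/
structure LinExt (R : Type*) [PartialOrder R] [Fintype R] where
  toEquiv : R ≃ Fin (Fintype.card R)
  monotone' : ∀ x y : R, x ≤ y → toEquiv x ≤ toEquiv y

open Classical in
/-- The Cartan matrix of `R` with respect to `σ`. -/
noncomputable def cartanMatrix {R : Type*} [PartialOrder R] [Fintype R] (σ : LinExt R) :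
    Matrix (Fin (Fintype.card R)) (Fin (Fintype.card R)) ℂ :=
  Matrix.of fun i j => if σ.toEquiv.symm j ≤ σ.toEquiv.symm i then 1 else 0

theorem cartanMatrix_det {R : Type*} [PartialOrder R] [Fintype R] (σ : LinExt R) :
    IsUnit (cartanMatrix σ).det := by
  rw [Matrix.det_of_isLowerTriangular]
  · simp [cartanMatrix]
  · intro i j hij
    have hij' : i < j := hij
    have : ¬ σ.toEquiv.symm j ≤ σ.toEquiv.symm i := by
      intro h
      have := σ.monotone' _ _ h
      simp only [Equiv.apply_symm_apply] at this
      exact absurd this (not_le.2 hij')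
    simp [cartanMatrix, this]

/-- Echelonmotion with respect to `σ`: it sends `x` to `y` exactly when the permutation matrix
`P` of the Bruhat cell of the Cartan matrix has its `1` of column `σ x` in row `σ y`. -/
noncomputable def echelonmotion {R : Type*} [PartialOrder R] [Fintype R] (σ : LinExt R) :
    Equiv.Perm R :=
  (σ.toEquiv.trans (bruhatPerm (cartanMatrix σ) (cartanMatrix_det σ))).trans σ.toEquiv.symm

/-- Echelonmotion does not depend on the linear extension. -/
def EchelonIndependent (R : Type*) [PartialOrder R] [Fintype R] : Prop :=
  ∀ σ σ' : LinExt R, echelonmotion σ = echelonmotion σ'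

/-! ### Semidistributive lattices and Barnard's rowmotion -/

def MeetSemidistributive (L : Type*) [Lattice L] : Prop :=
  ∀ x y : L, x ≤ y → ∃ m, IsGreatest {z : L | z ⊓ y = x} m

def JoinSemidistributive (L : Type*) [Lattice L] : Prop :=
  MeetSemidistributive Lᵒᵈ

def Semidistributive (L : Type*) [Lattice L] : Prop :=
  MeetSemidistributive L ∧ JoinSemidistributive L

/-- `j` is the label `j_{x,y}` of the cover relation `x ⋖ y`. -/
def IsEdgeLabel {L : Type*} [Lattice L] (x y j : L) : Prop :=
  x ⋖ y ∧ IsLeast {z : L | z ⊔ x = y} j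

/-- The downward label set of `w`. -/
def downLabels {L : Type*} [Lattice L] (w : L) : Set L :=
  {j | ∃ x, IsEdgeLabel x w j}

/-- The upward label set of `w`. -/
def upLabels {L : Type*} [Lattice L] (w : L) : Set L :=
  {j | ∃ y, IsEdgeLabel w y j}

/-- The property that characterizes rowmotion among the bijections of a semidistributive lattice:
the upward labels of the image of `w` are the downward labels of `w`. -/
def IsRowmotion {L : Type*} [Lattice L] (f : Equiv.Perm L) : Prop :=
  ∀ w, upLabels (f w) = downLabels w

end Echelon

/-!
The whole argument rests on one description of the Bruhat cell: `M ∈ B P B`, with `P` the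
permutation matrix of `π`, exactly when for every `j` there is a vector with last nonzero entry in
place `j` which `M` sends to a vector with last nonzero entry in place `π j`
(`inBruhatCell_of_vectors`, `exists_vector_of_inBruhatCell`), and `π j` is then the least place
that can be reached (`exists_ne_zero_of_inBruhatCell`). For the Cartan matrix of a poset, a vector
is a weight `c` on the poset and its image is the function `v ↦ ∑ z ≤ v, c z`.

*Semidistributive lattices.* Let `w` have the lower covers `x`, with labels `d x`, and let `κ x`
be the greatest `z` with `z ⊓ d x = d x ⊓ x`. The elements below `d x` other than `d x` are exactly
those below `d x ⊓ x`. Put `y = ⨅ κ x`. Then the upper covers of `y` are the elements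
`y ⊔ d x`, with labels `d x`, so that `w ↦ y` is rowmotion; it is injective because `w = ⨆ d x`.
Multiplying out `∏ x, ([d x ⊓ x ≤ v] - [d x ≤ v])` gives a weight supported on `v ≤ w`, nonzero
at `w` since replacing one `d x` by `d x ⊓ x` makes the join drop below `x`. The product itself
vanishes unless `v ≤ κ x` for all `x`, that is `v ≤ y`, and it is `1` at `y`. Hence echelonmotion
sends `w` to `y`, whatever the linear extension is.

*Echelon-independent lattices.* Let `j` be join-irreducible with lower cover `j₀`. If a linear
extension lists the elements below `j` first, echelonmotion sends `j` to the last element of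
`Z = {z | z ⊓ j = j₀}`. If this element `y` is the same for all these linear extensions, it is the
maximum of `Z`, as an element of `Z` not below `y` could be listed after `y`. The existence of these
maxima for all `j` implies meet-semidistributivity (`meetSemidistributive_of_joinIrreducible`).
Reversing the order inverts echelonmotion (`echelonmotion_dual`), which gives the dual property.
-/
namespace Echelon

/-! ### Bruhat cells through last nonzero entries -/

theorem inBruhatCell_of_vectors {n : ℕ} {M : Matrix (Fin n) (Fin n) ℂ} {π : Equiv.Perm (Fin n)}
    (c : Fin n → Fin n → ℂ) (hc : ∀ j, c j j ≠ 0) (hc' : ∀ j k, j < k → c j k = 0)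
    (hM : ∀ j, M.mulVec (c j) (π j) ≠ 0) (hM' : ∀ j k, π j < k → M.mulVec (c j) k = 0) :
    InBruhatCell M π := by
  let C : Matrix (Fin n) (Fin n) ℂ := Matrix.of fun i j => c j i
  have hC : C ∈ borel n := mem_borel_of_diag (fun i j hij => hc' j i hij) hc
  let A : Matrix (Fin n) (Fin n) ℂ := Matrix.of fun i k => M.mulVec (c (π.symm k)) i
  have hA : A ∈ borel n := by
    refine mem_borel_of_diag (fun i k hik => hM' _ _ (by simpa using hik)) (fun k => ?_)
    have h := hM (π.symm k)
    rwa [Equiv.apply_symm_apply] at h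
  have hMC : M * C = A * permMat π := by
    ext i j
    rw [mul_permMat_apply]
    simp [A, C, Matrix.mul_apply, Matrix.mulVec, dotProduct]
  refine ⟨A, hA, C⁻¹, borel_inv hC, ?_⟩
  rw [← hMC, Matrix.mul_assoc, Matrix.mul_nonsing_inv _ hC.2, Matrix.mul_one]

theorem exists_vector_of_inBruhatCell {n : ℕ} {M : Matrix (Fin n) (Fin n) ℂ}
    {π : Equiv.Perm (Fin n)} (h : InBruhatCell M π) (j : Fin n) :
    ∃ c : Fin n → ℂ, c j ≠ 0 ∧ (∀ k, j < k → c k = 0) ∧ ∀ k, π j < k → M.mulVec c k = 0 := by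
  obtain ⟨A, hA, C, hC, rfl⟩ := h
  have hC' := borel_inv hC
  refine ⟨fun k => C⁻¹ k j, borel_diag hC' j, fun k hk => hC'.1 k j hk, fun k hk => ?_⟩
  have e : (A * permMat π * C).mulVec (fun k => C⁻¹ k j) k = (A * permMat π * C * C⁻¹) k j := by
    rw [Matrix.mul_apply]
    rfl
  rw [e, Matrix.mul_assoc, Matrix.mul_nonsing_inv _ hC.2, Matrix.mul_one, mul_permMat_apply]
  exact hA.1 k _ hk

theorem exists_ne_zero_of_inBruhatCell {n : ℕ} {M : Matrix (Fin n) (Fin n) ℂ}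
    {π : Equiv.Perm (Fin n)} (h : InBruhatCell M π) {j : Fin n} {c : Fin n → ℂ} (hc : c j ≠ 0)
    (hc' : ∀ k, j < k → c k = 0) : ∃ k, π j ≤ k ∧ M.mulVec c k ≠ 0 := by
  by_contra! hz
  obtain ⟨A, hA, C, hC, rfl⟩ := h
  -- Both sides of `A⁻¹ (M c) = P (C c)` are compared in place `π j`.
  have e : A⁻¹.mulVec ((A * permMat π * C).mulVec c) = (permMat π * C).mulVec c := by
    rw [Matrix.mulVec_mulVec, Matrix.mul_assoc A, Matrix.nonsing_inv_mul_cancel_left _ _ hA.2]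
  have e1 : A⁻¹.mulVec ((A * permMat π * C).mulVec c) (π j) = 0 := by
    rw [Matrix.mulVec, dotProduct]
    refine Finset.sum_eq_zero fun k _ => ?_
    rcases lt_or_ge k (π j) with hk | hk
    · rw [(borel_inv hA).1 _ _ hk, zero_mul]
    · rw [hz k hk, mul_zero]
  rw [e, Matrix.mulVec, dotProduct, Finset.sum_eq_single j] at e1
  · rw [permMat_mul_apply, Equiv.symm_apply_apply] at e1
    exact mul_ne_zero (borel_diag hC j) hc e1
  · intro k _ hk
    rcases lt_or_gt_of_ne hk with hk | hk
    · rw [permMat_mul_apply, Equiv.symm_apply_apply, hC.1 _ _ hk, zero_mul]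
    · rw [hc' k hk, mul_zero]
  · simp

/-- The reflection in the antidiagonal preserves upper-triangular matrices and reverses products. -/
theorem inBruhatCell_antitranspose {n : ℕ} {M : Matrix (Fin n) (Fin n) ℂ}
    {π : Equiv.Perm (Fin n)} (h : InBruhatCell M π) :
    InBruhatCell (Matrix.of fun i j => M j.rev i.rev)
      ((Fin.revPerm.trans π.symm).trans Fin.revPerm) := by
  obtain ⟨A, hA, C, hC, rfl⟩ := h
  have hr : ∀ {D : Matrix (Fin n) (Fin n) ℂ}, D ∈ borel n →
      (Matrix.of fun i j => D j.rev i.rev) ∈ borel n := fun hD =>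
    mem_borel_of_diag (fun i j hij => hD.1 _ _ (Fin.rev_lt_rev.2 hij)) fun i => borel_diag hD _
  refine ⟨_, hr hC, _, hr hA, ?_⟩
  ext i j
  rw [Matrix.of_apply, Matrix.mul_assoc, Matrix.mul_apply, Matrix.mul_apply]
  refine Fintype.sum_equiv Fin.revPerm _ _ fun k => ?_
  simp [mul_permMat_apply, permMat_mul_apply, mul_comm]

/-! ### Weights on a poset and echelonmotion -/

section Poset

variable {R : Type*} [PartialOrder R] [Fintype R]

open Classical in
/-- The image of the weight `c` under the Cartan matrix, as a function on the poset. -/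
noncomputable def lowerSum (c : R → ℂ) (v : R) : ℂ :=
  ∑ z, if z ≤ v then c z else 0

theorem cartanMatrix_mulVec (σ : LinExt R) (c : Fin (Fintype.card R) → ℂ)
    (i : Fin (Fintype.card R)) :
    (cartanMatrix σ).mulVec c i = lowerSum (c ∘ σ.toEquiv) (σ.toEquiv.symm i) := by
  rw [Matrix.mulVec, dotProduct, lowerSum]
  refine Fintype.sum_equiv σ.toEquiv.symm _ _ fun k => ?_
  simp [cartanMatrix]

theorem inBruhatCell_cartanMatrix (σ : LinExt R) :
    InBruhatCell (cartanMatrix σ) ((σ.toEquiv.symm.trans (echelonmotion σ)).trans σ.toEquiv) := by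
  rw [inBruhatCell_iff _ (cartanMatrix_det σ)]
  ext i
  simp [echelonmotion]

theorem echelonmotion_eq_of_inBruhatCell (σ : LinExt R) (f : Equiv.Perm R)
    (h : InBruhatCell (cartanMatrix σ) ((σ.toEquiv.symm.trans f).trans σ.toEquiv)) :
    echelonmotion σ = f := by
  have e := bruhat_unique (inBruhatCell_cartanMatrix σ) h
  ext x
  have := congrArg σ.toEquiv.symm (Equiv.congr_fun e (σ.toEquiv x))
  simpa using this

theorem echelonmotion_eq_of_weights (σ : LinExt R) (f : Equiv.Perm R) (c : R → R → ℂ)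
    (hc : ∀ w, c w w ≠ 0) (hc' : ∀ w z, c w z ≠ 0 → z ≤ w)
    (hF : ∀ w, lowerSum (c w) (f w) ≠ 0) (hF' : ∀ w v, lowerSum (c w) v ≠ 0 → v ≤ f w) :
    echelonmotion σ = f := by
  apply echelonmotion_eq_of_inBruhatCell
  have e : ∀ j, (c (σ.toEquiv.symm j) ∘ σ.toEquiv.symm) ∘ σ.toEquiv = c (σ.toEquiv.symm j) :=
    fun j => by ext; simp
  refine inBruhatCell_of_vectors (fun j => c (σ.toEquiv.symm j) ∘ σ.toEquiv.symm)
    (fun j => hc _) (fun j k hjk => ?_) (fun j => ?_) (fun j k hjk => ?_)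
  · by_contra hne
    have := σ.monotone' _ _ (hc' _ _ hne)
    simp only [Equiv.apply_symm_apply] at this
    exact absurd this (not_le.2 hjk)
  · rw [cartanMatrix_mulVec, e]
    simpa using hF _
  · rw [cartanMatrix_mulVec, e]
    by_contra hne
    have := σ.monotone' _ _ (hF' _ _ hne)
    rw [Equiv.apply_symm_apply] at this
    exact absurd this (not_le.2 hjk)

theorem exists_weight_of_echelonmotion (σ : LinExt R) (w : R) :
    ∃ c : R → ℂ, c w ≠ 0 ∧ (∀ z, c z ≠ 0 → σ.toEquiv z ≤ σ.toEquiv w) ∧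
      ∀ v, lowerSum c v ≠ 0 → σ.toEquiv v ≤ σ.toEquiv (echelonmotion σ w) := by
  obtain ⟨c, h1, h2, h3⟩ :=
    exists_vector_of_inBruhatCell (inBruhatCell_cartanMatrix σ) (σ.toEquiv w)
  refine ⟨c ∘ σ.toEquiv, h1, fun z hz => ?_, fun v hv => ?_⟩
  · by_contra hlt
    exact hz (h2 _ (not_le.1 hlt))
  · by_contra hlt
    have := h3 (σ.toEquiv v) (by simpa using hlt)
    rw [cartanMatrix_mulVec, Equiv.symm_apply_apply] at this
    exact hv this

theorem exists_ge_echelonmotion (σ : LinExt R) {w : R} {c : R → ℂ} (hc : c w ≠ 0)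
    (hc' : ∀ z, c z ≠ 0 → z ≤ w) :
    ∃ v, σ.toEquiv (echelonmotion σ w) ≤ σ.toEquiv v ∧ lowerSum c v ≠ 0 := by
  obtain ⟨k, h1, h2⟩ := exists_ne_zero_of_inBruhatCell (inBruhatCell_cartanMatrix σ)
    (j := σ.toEquiv w) (c := c ∘ σ.toEquiv.symm) (by simpa using hc) (fun k hk => by
      by_contra hne
      have := σ.monotone' _ _ (hc' _ hne)
      rw [Equiv.apply_symm_apply] at this
      exact absurd this (not_le.2 hk))
  rw [cartanMatrix_mulVec] at h2
  have e : (c ∘ σ.toEquiv.symm) ∘ σ.toEquiv = c := by ext; simp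
  rw [e] at h2
  exact ⟨_, by simpa using h1, h2⟩

/-! ### Construction and reversal of linear extensions -/

/-- A finite poset can be listed in the order of any monotone function. -/
theorem exists_linExt_of_monotone {f : R → ℕ} (hf : Monotone f) :
    ∃ σ : LinExt R, ∀ x y, f x < f y → σ.toEquiv x < σ.toEquiv y := by
  let key : R → ℕ ×ₗ LinearExtension R := fun x => toLex (f x, toLinearExtension x)
  have hkey : Function.Injective key := fun x y h => congrArg (fun p => (ofLex p).2) h
  have hmono : ∀ x y, x ≤ y → key x ≤ key y := by
    intro x y h
    rw [Prod.Lex.toLex_le_toLex]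
    rcases (hf h).lt_or_eq with h1 | h1
    · exact Or.inl h1
    · exact Or.inr ⟨h1, toLinearExtension.monotone h⟩
  let s : Finset (ℕ ×ₗ LinearExtension R) := Finset.univ.map ⟨key, hkey⟩
  let e : R ≃ s := Equiv.ofBijective (fun x => ⟨key x, by simp [s]⟩)
    ⟨fun x y h => hkey (congrArg Subtype.val h), fun ⟨k, hk⟩ => by
      obtain ⟨x, -, hx⟩ := Finset.mem_map.1 hk
      exact ⟨x, Subtype.ext hx⟩⟩
  let o : Fin (Fintype.card R) ≃o s := s.orderIsoOfFin (by simp [s])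
  refine ⟨⟨e.trans o.symm.toEquiv, fun x y h => o.symm.monotone (hmono x y h)⟩, fun x y h => ?_⟩
  refine o.symm.strictMono (show key x < key y from ?_)
  rw [Prod.Lex.toLex_lt_toLex]
  exact Or.inl h

/-- A linear extension read backwards. -/
def LinExt.ofDual (σ : LinExt Rᵒᵈ) : LinExt R where
  toEquiv := (OrderDual.toDual.trans σ.toEquiv).trans Fin.revPerm
  monotone' x y h := Fin.rev_le_rev.2 (σ.monotone' (OrderDual.toDual y) (OrderDual.toDual x) h)

theorem echelonmotion_dual (σ : LinExt Rᵒᵈ) (x : R) :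
    echelonmotion σ (OrderDual.toDual x) =
      OrderDual.toDual ((echelonmotion σ.ofDual).symm x) := by
  have hσ : ∀ k, σ.ofDual.toEquiv.symm (Fin.rev k) = OrderDual.ofDual (σ.toEquiv.symm k) :=
    fun k => congrArg (fun l => OrderDual.ofDual (σ.toEquiv.symm l)) (Fin.rev_rev k)
  have hM' : ∀ i j : Fin (Fintype.card R),
      cartanMatrix σ.ofDual j.rev i.rev = cartanMatrix σ i j := fun i j => by
    rw [cartanMatrix, Matrix.of_apply, hσ, hσ]
    rfl
  have hM : (Matrix.of fun i j => cartanMatrix σ.ofDual j.rev i.rev) = cartanMatrix σ :=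
    Matrix.ext hM'
  have h := (congrArg (fun X => InBruhatCell X _) hM).mp
    (inBruhatCell_antitranspose (inBruhatCell_cartanMatrix σ.ofDual))
  have e := echelonmotion_eq_of_inBruhatCell σ
    ((OrderDual.ofDual.trans (echelonmotion σ.ofDual).symm).trans OrderDual.toDual) (by
      convert h using 1
      refine Equiv.ext fun i => ?_
      change _ = Fin.rev (Fin.rev (σ.toEquiv (OrderDual.toDual ((echelonmotion σ.ofDual).symm
        (OrderDual.ofDual (σ.toEquiv.symm (Fin.rev (Fin.rev i))))))))
      rw [Fin.rev_rev, Fin.rev_rev]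
      rfl)
  exact Equiv.congr_fun e (OrderDual.toDual x)

theorem EchelonIndependent.dual (h : EchelonIndependent R) : EchelonIndependent Rᵒᵈ := by
  intro σ σ'
  ext x
  exact (echelonmotion_dual σ (OrderDual.ofDual x)).trans
    ((congrArg (fun f : Equiv.Perm R => OrderDual.toDual (f.symm (OrderDual.ofDual x)))
      (h σ.ofDual σ'.ofDual)).trans (echelonmotion_dual σ' (OrderDual.ofDual x)).symm)

end Poset

/-! ### Semidistributive lattices -/

section Semidistributive

variable {L : Type*} [Lattice L]

theorem JoinSemidistributive.exists_isLeast (h : JoinSemidistributive L) {x y : L} (hxy : x ≤ y) :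
    ∃ m, IsLeast {z : L | z ⊔ x = y} m :=
  h (OrderDual.toDual y) (OrderDual.toDual x) hxy

/-- For an element `w`, the labels `d x` of the cover relations `x ⋖ w` together with the
greatest elements `κ x` that meet `d x` in its lower cover `d x ⊓ x`. The values of `d` and `κ`
outside the lower covers of `w` are arbitrary. -/
structure LowerCoverData (w : L) where
  d : L → L
  κ : L → L
  isLeast : ∀ x, x ⋖ w → IsLeast {z : L | z ⊔ x = w} (d x)
  isGreatest : ∀ x, x ⋖ w → IsGreatest {z : L | z ⊓ d x = d x ⊓ x} (κ x)

theorem Semidistributive.nonempty_lowerCoverData (h : Semidistributive L) (w : L) :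
    Nonempty (LowerCoverData w) := by
  have h1 : ∀ x : L, ∃ d, x ⋖ w → IsLeast {z : L | z ⊔ x = w} d := fun x => by
    by_cases hx : x ⋖ w
    · obtain ⟨d, hd⟩ := h.2.exists_isLeast hx.le
      exact ⟨d, fun _ => hd⟩
    · exact ⟨x, fun h => absurd h hx⟩
  choose d hd using h1
  choose κ hκ using fun x : L => h.1 (d x ⊓ x) (d x) inf_le_left
  exact ⟨⟨d, κ, hd, fun x _ => hκ x⟩⟩

namespace LowerCoverData

variable {w : L} (D : LowerCoverData w)

theorem sup_eq {x : L} (hx : x ⋖ w) : D.d x ⊔ x = w := (D.isLeast x hx).1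

theorem d_le {x : L} (hx : x ⋖ w) : D.d x ≤ w := le_sup_left.trans (D.sup_eq hx).le

theorem not_d_le {x : L} (hx : x ⋖ w) : ¬ D.d x ≤ x := fun h =>
  hx.ne ((sup_eq_right.2 h).symm.trans (D.sup_eq hx))

theorem le_of_lt {x t : L} (hx : x ⋖ w) (ht : t < D.d x) : t ≤ D.d x ⊓ x := by
  refine le_inf ht.le ?_
  by_contra hne
  have h1 : x < t ⊔ x := lt_of_le_of_ne le_sup_right fun h => hne (sup_eq_right.1 h.symm)
  have h2 : t ⊔ x = w := 
    (hx.eq_or_eq h1.le (sup_le (ht.le.trans (D.d_le hx)) hx.le)).resolve_left h1.ne'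
  exact ht.not_ge ((D.isLeast x hx).2 h2)

theorem d_le_of_ne {x x' : L} (hx : x ⋖ w) (hx' : x' ⋖ w) (hne : x ≠ x') : D.d x ≤ x' := by
  apply (D.isLeast x hx).2
  refine (hx.eq_or_eq le_sup_right (sup_le hx'.le hx.le)).resolve_left fun e => ?_
  rcases hx'.eq_or_eq (sup_eq_right.1 e) hx.le with h | h
  · exact hne h
  · exact hx.ne h

theorem not_d_le_κ {x : L} (hx : x ⋖ w) : ¬ D.d x ≤ D.κ x := fun h => by
  have := (D.isGreatest x hx).1
  rw [Set.mem_ofPred_eq, inf_eq_right.2 h] at this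
  exact D.not_d_le hx (this.le.trans inf_le_right)

theorem inf_le_κ {x : L} (hx : x ⋖ w) : D.d x ⊓ x ≤ D.κ x :=
  (D.isGreatest x hx).1.ge.trans inf_le_left

/-- Above the lower cover of `d x`, the element `κ x` is the maximum of those not above `d x`. -/
theorem le_κ {x v : L} (hx : x ⋖ w) (h1 : D.d x ⊓ x ≤ v) (h2 : ¬ D.d x ≤ v) : v ≤ D.κ x := by
  apply (D.isGreatest x hx).2
  refine le_antisymm (D.le_of_lt hx (lt_of_le_of_ne inf_le_right fun h => h2 ?_))
    (le_inf h1 inf_le_left)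
  exact inf_eq_right.1 h

theorem le_κ_self {x : L} (hx : x ⋖ w) : x ≤ D.κ x := D.le_κ hx inf_le_right (D.not_d_le hx)

theorem d_le_κ_of_ne {x x' : L} (hx : x ⋖ w) (hx' : x' ⋖ w) (hne : x ≠ x') : D.d x ≤ D.κ x' :=
  (D.d_le_of_ne hx hx' hne).trans (D.le_κ_self hx')

theorem downLabels_eq : downLabels w = {j | ∃ x, x ⋖ w ∧ D.d x = j} := by
  ext j
  exact exists_congr fun x => and_congr_right fun hx =>
    ⟨fun h => (D.isLeast x hx).unique h, fun h => h ▸ D.isLeast x hx⟩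

variable [Fintype L]

open Classical in
/-- The lower covers of `w`. -/
noncomputable def covers (_ : LowerCoverData w) : Finset L := Finset.univ.filter (· ⋖ w)

theorem mem_covers {x : L} : x ∈ D.covers ↔ x ⋖ w := by simp [covers]

variable [BoundedOrder L]

/-- The image of `w` under rowmotion: the meet of the elements `κ x`. -/
noncomputable def row : L := D.covers.inf D.κ

theorem row_le {x : L} (hx : x ⋖ w) : D.row ≤ D.κ x := Finset.inf_le (D.mem_covers.2 hx)

theorem le_row {v : L} (h : ∀ x, x ⋖ w → v ≤ D.κ x) : v ≤ D.row :=
  Finset.le_inf fun x hx => h x (D.mem_covers.1 hx)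

theorem inf_le_row {x : L} (hx : x ⋖ w) : D.d x ⊓ x ≤ D.row := by
  refine D.le_row fun x' hx' => ?_
  by_cases h : x = x'
  · exact h ▸ D.inf_le_κ hx
  · exact inf_le_left.trans (D.d_le_κ_of_ne hx hx' h)

theorem not_d_le_row {x : L} (hx : x ⋖ w) : ¬ D.d x ≤ D.row := fun h =>
  D.not_d_le_κ hx (h.trans (D.row_le hx))

theorem exists_d_le_of_row_lt {u : L} (hu : D.row < u) : ∃ x, x ⋖ w ∧ D.d x ≤ u := by
  by_contra! h
  exact hu.not_ge (D.le_row fun x hx => D.le_κ hx ((D.inf_le_row hx).trans hu.le) (h x hx))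

theorem row_covBy {x : L} (hx : x ⋖ w) : D.row ⋖ D.row ⊔ D.d x := by
  refine ⟨lt_of_le_of_ne le_sup_left fun h => D.not_d_le_row hx (sup_eq_left.1 h.symm), ?_⟩
  intro u hu hu'
  obtain ⟨x', hx', hd⟩ := D.exists_d_le_of_row_lt hu
  by_cases h : x = x'
  · exact hu'.not_ge (sup_le hu.le (h ▸ hd))
  · exact D.not_d_le_κ hx' ((hd.trans hu'.le).trans
      (sup_le (D.row_le hx') (D.d_le_κ_of_ne hx hx' h)))

theorem isEdgeLabel_row (h : JoinSemidistributive L) {x : L} (hx : x ⋖ w) :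
    IsEdgeLabel D.row (D.row ⊔ D.d x) (D.d x) := by
  refine ⟨D.row_covBy hx, ?_⟩
  obtain ⟨m, hm⟩ := h.exists_isLeast (D.row_covBy hx).le
  have hmd : m ≤ D.d x := hm.2 (sup_comm _ _)
  rcases hmd.lt_or_eq with hlt | rfl
  · have : m ⊔ D.row = D.row := sup_eq_right.2 ((D.le_of_lt hx hlt).trans (D.inf_le_row hx))
    exact absurd (this.symm.trans hm.1) (D.row_covBy hx).ne
  · exact hm

theorem upLabels_row (h : JoinSemidistributive L) : upLabels D.row = downLabels w := by
  rw [D.downLabels_eq]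
  ext j
  constructor
  · rintro ⟨z, hz, hj⟩
    obtain ⟨x, hx, hd⟩ := D.exists_d_le_of_row_lt hz.lt
    have e : D.row ⊔ D.d x = z := 
      (hz.eq_or_eq le_sup_left (sup_le hz.le hd)).resolve_left (D.row_covBy hx).ne'
    exact ⟨x, hx, (e ▸ (D.isEdgeLabel_row h hx).2).unique hj⟩
  · rintro ⟨x, hx, rfl⟩
    exact ⟨_, D.isEdgeLabel_row h hx⟩

theorem sup_d_eq : D.covers.sup D.d = w := by
  have hle : D.covers.sup D.d ≤ w := Finset.sup_le fun x hx => D.d_le (D.mem_covers.1 hx)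
  by_contra hne
  obtain ⟨x, hx, hxw⟩ := exists_le_covBy_of_lt (lt_of_le_of_ne hle hne)
  exact D.not_d_le hxw ((Finset.le_sup (D.mem_covers.2 hxw)).trans hx)

/-- The join of the labels `d x` over `t` and of their lower covers over the other `x`. -/
noncomputable def mixedJoin [DecidableEq L] (t : Finset L) : L :=
  t.sup D.d ⊔ (D.covers \ t).sup fun x => D.d x ⊓ x

theorem mixedJoin_le [DecidableEq L] {t : Finset L} (ht : t ⊆ D.covers) : D.mixedJoin t ≤ w :=
  sup_le (Finset.sup_le fun _ hx => D.d_le (D.mem_covers.1 (ht hx))) (Finset.sup_le fun _ hx =>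
    inf_le_left.trans (D.d_le (D.mem_covers.1 (Finset.sdiff_subset hx))))

theorem mixedJoin_eq_iff [DecidableEq L] {t : Finset L} (ht : t ⊆ D.covers) :
    D.mixedJoin t = w ↔ t = D.covers := by
  refine ⟨fun h => ht.antisymm fun x hx => ?_, ?_⟩
  · by_contra hxt
    have hx' := D.mem_covers.1 hx
    -- All joinands lie below the lower cover `x`.
    refine hx'.lt.not_ge (h.symm.le.trans (sup_le ?_ ?_))
    · exact Finset.sup_le fun x' h' => D.d_le_of_ne (D.mem_covers.1 (ht h')) hx'
        fun e => hxt (e ▸ h')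
    · refine Finset.sup_le fun x' h' => ?_
      by_cases e : x' = x
      · exact e ▸ inf_le_right
      · exact inf_le_left.trans
          (D.d_le_of_ne (D.mem_covers.1 (Finset.sdiff_subset h')) hx' e)
  · rintro rfl
    simp [mixedJoin, D.sup_d_eq]

open Classical in
/-- The weight obtained by multiplying out `∏ x, ([d x ⊓ x ≤ v] - [d x ≤ v])`. -/
noncomputable def weight (z : L) : ℂ :=
  ∑ t ∈ D.covers.powerset, if D.mixedJoin t = z then (-1) ^ t.card else 0

open Classical in
theorem lowerSum_weight (v : L) : lowerSum D.weight v =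
    ∏ x ∈ D.covers, (-(if D.d x ≤ v then 1 else 0) + if D.d x ⊓ x ≤ v then 1 else 0) := by
  have hind : ∀ (s : Finset L) (g : L → L),
      (∏ x ∈ s, if g x ≤ v then (1 : ℂ) else 0) = if s.sup g ≤ v then 1 else 0 := fun s g => by
    simp only [Finset.prod_ite_zero, Finset.prod_const_one, Finset.sup_le_iff]
  have hswap : ∀ z, (if z ≤ v then D.weight z else 0) = ∑ t ∈ D.covers.powerset,
      if D.mixedJoin t = z then (if z ≤ v then (-1) ^ t.card else 0) else 0 := fun z => by
    rw [weight]
    split_ifs <;> simp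
  rw [Finset.prod_add, lowerSum]
  simp only [hswap]
  rw [Finset.sum_comm]
  refine Finset.sum_congr rfl fun t _ => ?_
  rw [Fintype.sum_ite_eq, Finset.prod_neg, hind, hind, mixedJoin]
  simp only [sup_le_iff, ite_and]
  split_ifs <;> simp

theorem weight_self : D.weight w ≠ 0 := by
  classical
  rw [weight, Finset.sum_eq_single D.covers]
  · rw [if_pos ((D.mixedJoin_eq_iff subset_rfl).2 rfl)]
    exact pow_ne_zero _ (by norm_num)
  · intro t ht hne
    exact if_neg fun h => hne ((D.mixedJoin_eq_iff (Finset.mem_powerset.1 ht)).1 h)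
  · simp

theorem le_of_weight_ne_zero {z : L} (h : D.weight z ≠ 0) : z ≤ w := by
  classical
  obtain ⟨t, ht, hne⟩ := Finset.exists_ne_zero_of_sum_ne_zero h
  have := (ite_ne_right_iff.1 hne).1
  exact this ▸ D.mixedJoin_le (Finset.mem_powerset.1 ht)

theorem lowerSum_weight_row : lowerSum D.weight D.row ≠ 0 := by
  classical
  rw [lowerSum_weight, Finset.prod_ne_zero_iff]
  intro x hx
  have hx' := D.mem_covers.1 hx
  simp [D.not_d_le_row hx', D.inf_le_row hx']

theorem le_row_of_lowerSum_ne_zero {v : L} (h : lowerSum D.weight v ≠ 0) : v ≤ D.row := by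
  classical
  rw [lowerSum_weight, Finset.prod_ne_zero_iff] at h
  refine D.le_row fun x hx => ?_
  have hne := h x (D.mem_covers.2 hx)
  by_cases h1 : D.d x ≤ v
  · simp [h1, inf_le_left.trans h1] at hne
  · exact D.le_κ hx (by by_contra h2; simp [h1, h2] at hne) h1

end LowerCoverData

theorem downLabels_injective [Fintype L] [BoundedOrder L] (h : Semidistributive L) :
    Function.Injective (downLabels : L → Set L) := by
  have key : ∀ w w' : L, downLabels w = downLabels w' → w ≤ w' := by
    intro w w' e
    obtain ⟨D⟩ := h.nonempty_lowerCoverData w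
    obtain ⟨D'⟩ := h.nonempty_lowerCoverData w'
    rw [D.downLabels_eq, D'.downLabels_eq] at e
    refine D.sup_d_eq.ge.trans (Finset.sup_le fun x hx => ?_)
    obtain ⟨x', hx', hd⟩ := e.le ⟨x, D.mem_covers.1 hx, rfl⟩
    exact hd ▸ D'.d_le hx'
  exact fun w w' e => (key w w' e).antisymm (key w' w e.symm)

theorem Semidistributive.exists_row [Fintype L] [BoundedOrder L] (h : Semidistributive L) :
    ∃ row : Equiv.Perm L, (∀ f : Equiv.Perm L, IsRowmotion f ↔ f = row) ∧
      ∀ σ : LinExt L, echelonmotion σ = row := by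
  have D : ∀ w, LowerCoverData w := fun w => (h.nonempty_lowerCoverData w).some
  have hrow : ∀ w, upLabels (D w).row = downLabels w := fun w => (D w).upLabels_row h.2
  have hinj : Function.Injective fun w => (D w).row := fun w w' e =>
    downLabels_injective h ((hrow w).symm.trans ((congrArg upLabels e).trans (hrow w')))
  let row : Equiv.Perm L := Equiv.ofBijective _ (Finite.injective_iff_bijective.1 hinj)
  refine ⟨row, fun f => ⟨fun hf => ?_, fun e => e ▸ hrow⟩, fun σ => ?_⟩
  · ext w
    obtain ⟨w', hw'⟩ := row.surjective (f w)
    have e : downLabels w' = downLabels w := by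
      rw [← hf w, ← hw']
      exact (hrow w').symm
    rw [← hw', downLabels_injective h e]
  · exact echelonmotion_eq_of_weights σ row (fun w => (D w).weight) (fun w => (D w).weight_self)
      (fun w _ => (D w).le_of_weight_ne_zero) (fun w => (D w).lowerSum_weight_row)
      (fun w _ => (D w).le_row_of_lowerSum_ne_zero)

end Semidistributive

/-! ### Echelon-independent lattices -/

section Independent

variable {L : Type*} [Lattice L] [Fintype L]

theorem meetSemidistributive_of_joinIrreducible [OrderTop L]
    (h : ∀ j j₀ : L, j₀ < j → (∀ t < j, t ≤ j₀) → ∃ m, IsGreatest {z : L | z ⊓ j = j₀} m) :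
    MeetSemidistributive L := by
  intro x y hxy
  have hsup : ∀ a b : L, a ⊓ y = x → b ⊓ y = x → (a ⊔ b) ⊓ y = x := by
    intro a b ha hb
    by_contra hne
    have hxa : x ≤ a := ha.ge.trans inf_le_left
    have hxb : x ≤ b := hb.ge.trans inf_le_left
    have hle : x ≤ (a ⊔ b) ⊓ y := le_inf (hxa.trans le_sup_left) hxy
    obtain ⟨j, ⟨hj1, hj2⟩, hmin⟩ := WellFounded.has_min (wellFounded_lt (α := L))
      {j | j ≤ (a ⊔ b) ⊓ y ∧ ¬ j ≤ x} ⟨_, le_rfl, fun h => hne (h.antisymm hle)⟩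
    have hlt : ∀ t < j, t ≤ j ⊓ x := fun t ht => le_inf ht.le <| by
      by_contra htx
      exact hmin t ⟨ht.le.trans hj1, htx⟩ ht
    have hstar : ∀ c : L, c ⊓ y = x → c ⊓ j = j ⊓ x := fun c hc => by
      refine le_antisymm (hlt _ (lt_of_le_of_ne inf_le_right fun e => hj2 ?_))
        (le_inf (inf_le_right.trans (hc.ge.trans inf_le_left)) inf_le_left)
      exact hc ▸ le_inf (inf_eq_right.1 e) (hj1.trans inf_le_right)
    obtain ⟨m, hm, hmax⟩ := h j (j ⊓ x)
      (lt_of_le_of_ne inf_le_left fun e => hj2 (inf_eq_left.1 e)) hlt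
    have hjm : j ≤ m := (hj1.trans inf_le_left).trans
      (sup_le (hmax (hstar a ha)) (hmax (hstar b hb)))
    rw [Set.mem_ofPred_eq, inf_eq_right.2 hjm] at hm
    exact hj2 (inf_eq_left.1 hm.symm)
  obtain ⟨m, hm⟩ := (Set.toFinite {z : L | z ⊓ y = x}).exists_maximal ⟨x, inf_eq_left.2 hxy⟩
  refine ⟨m, hm.1, fun z hz => ?_⟩
  exact le_sup_right.trans (hm.2 (hsup m z hm.1 hz) le_sup_left)

/-- If the elements below the join-irreducible `j` are listed first, echelonmotion sends `j` to the
last element that meets `j` in its lower cover `j₀`. -/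
theorem echelonmotion_joinIrreducible [OrderTop L] {j j₀ : L} (hlt : j₀ < j)
    (hj : ∀ t < j, t ≤ j₀) (σ : LinExt L)
    (hσ : ∀ z, σ.toEquiv z ≤ σ.toEquiv j → z ≤ j) :
    echelonmotion σ j ⊓ j = j₀ ∧
      ∀ z, z ⊓ j = j₀ → σ.toEquiv z ≤ σ.toEquiv (echelonmotion σ j) := by
  classical
  have hmax : ∀ z, z ⊓ j = j₀ → σ.toEquiv z ≤ σ.toEquiv (echelonmotion σ j) := by
    intro z hz
    obtain ⟨c, hc, hcj, hF⟩ := exists_weight_of_echelonmotion σ j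
    -- The sum at `⊤` exceeds the sum at `z` by `c j`, so that one of the two is nonzero.
    have hdiff : lowerSum c ⊤ = lowerSum c z + c j := by
      rw [lowerSum, lowerSum, ← Fintype.sum_ite_eq j c, ← Finset.sum_add_distrib]
      refine Finset.sum_congr rfl fun t _ => ?_
      by_cases ht : c t = 0
      · simp [ht]
      have htj := hσ t (hcj t ht)
      rcases htj.lt_or_eq with h | rfl
      · simp [(hj t h).trans (hz.ge.trans inf_le_left), h.ne']
      · have : ¬ t ≤ z := fun h => hlt.ne (hz.symm.trans (inf_eq_right.2 h))
        simp [this]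
    by_cases h : lowerSum c z = 0
    · rw [h, zero_add] at hdiff
      exact (σ.monotone' z ⊤ le_top).trans (hF ⊤ (hdiff ▸ hc))
    · exact hF z h
  refine ⟨?_, hmax⟩
  obtain ⟨v, hv, hne⟩ := exists_ge_echelonmotion σ (w := j)
    (c := fun z => (if j = z then 1 else 0) - if j₀ = z then 1 else 0)
    (by simp [hlt.ne]) (fun z hz => by
      by_contra h
      have h1 : j ≠ z := fun e => h e.ge
      have h2 : j₀ ≠ z := fun e => h (e ▸ hlt.le)
      simp [h1, h2] at hz)
  have hsum : lowerSum (fun z => (if j = z then (1 : ℂ) else 0) - if j₀ = z then 1 else 0) v =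
      (if j ≤ v then 1 else 0) - if j₀ ≤ v then 1 else 0 := by
    have : ∀ z, (if z ≤ v then (if j = z then (1 : ℂ) else 0) - (if j₀ = z then 1 else 0) else 0) =
        (if j = z then (if z ≤ v then 1 else 0) else 0) -
          if j₀ = z then (if z ≤ v then 1 else 0) else 0 := fun z => by
      split_ifs <;> simp
    simp only [lowerSum, this, Finset.sum_sub_distrib, Fintype.sum_ite_eq]
  rw [hsum] at hne
  have hvZ : v ⊓ j = j₀ := by
    by_cases h1 : j ≤ v
    · simp [h1, hlt.le.trans h1] at hne
    · have h2 : j₀ ≤ v := by by_contra h2; simp [h1, h2] at hne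
      exact le_antisymm (hj _ (lt_of_le_of_ne inf_le_right fun e => h1 (inf_eq_right.1 e)))
        (le_inf h2 hlt.le)
  rwa [σ.toEquiv.injective (hv.antisymm (hmax v hvZ))]

theorem EchelonIndependent.meetSemidistributive [OrderTop L] (h : EchelonIndependent L) :
    MeetSemidistributive L := by
  classical
  refine meetSemidistributive_of_joinIrreducible fun j j₀ hlt hj => ?_
  -- A linear extension that lists the elements below `j` first, then those below `y`.
  have hex : ∀ y : L, ∃ σ : LinExt L, (∀ z, σ.toEquiv z ≤ σ.toEquiv j → z ≤ j) ∧
      ∀ z, ¬ z ≤ j → σ.toEquiv z ≤ σ.toEquiv y → z ≤ y := by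
    intro y
    let f : L → ℕ := fun z => if z ≤ j then 0 else if z ≤ y then 1 else 2
    have hf : Monotone f := by
      intro a b hab
      by_cases h1 : b ≤ j
      · simp [f, h1, hab.trans h1]
      by_cases h2 : b ≤ y
      · simp only [f, if_neg h1, if_pos h2, if_pos (hab.trans h2)]
        split_ifs <;> omega
      · simp only [f, if_neg h1, if_neg h2]
        split_ifs <;> omega
    obtain ⟨σ, hσ⟩ := exists_linExt_of_monotone hf
    refine ⟨σ, fun z hz => ?_, fun z hzj hz => ?_⟩
    · by_contra hzj
      refine (hσ j z ?_).not_ge hz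
      simp only [f, if_neg hzj, if_pos (le_refl j)]
      split_ifs <;> omega
    · by_contra hzy
      refine (hσ y z ?_).not_ge hz
      simp only [f, if_neg hzj, if_neg hzy, if_pos (le_refl y)]
      split_ifs <;> omega
  obtain ⟨σ₀, hσ₀, -⟩ := hex j
  refine ⟨echelonmotion σ₀ j, (echelonmotion_joinIrreducible hlt hj σ₀ hσ₀).1, fun z hz => ?_⟩
  obtain ⟨σ, hσ, hσ'⟩ := hex (echelonmotion σ₀ j)
  obtain ⟨h1, h2⟩ := echelonmotion_joinIrreducible hlt hj σ hσ
  rw [h σ σ₀] at h1 h2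
  by_cases hzj : z ≤ j
  · rw [← (inf_eq_left.2 hzj).symm.trans hz] at h1
    exact h1.ge.trans inf_le_left
  · exact hσ' z hzj (h2 z hz)

end Independent

end Echelon

theorem theorem1p1 {L : Type*} [Lattice L] [Fintype L] :
    (Echelon.Semidistributive L →
      (∃ row : Equiv.Perm L,
        (∀ f : Equiv.Perm L, Echelon.IsRowmotion f ↔ f = row) ∧
        ∀ σ : Echelon.LinExt L, Echelon.echelonmotion σ = row) ∧
      Echelon.EchelonIndependent L) ∧
    (Echelon.EchelonIndependent L → Echelon.Semidistributive L) := by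
  cases isEmpty_or_nonempty L
  · exact ⟨fun _ => ⟨⟨1, fun f => ⟨fun _ => Subsingleton.elim _ _, fun _ w => isEmptyElim w⟩,
      fun σ => Subsingleton.elim _ _⟩, fun σ σ' => Subsingleton.elim _ _⟩,
      fun _ => ⟨fun x => isEmptyElim x, fun x => isEmptyElim (OrderDual.ofDual x)⟩⟩
  · have : BoundedOrder L := Fintype.toBoundedOrder L
    refine ⟨fun h => ?_, fun h => ⟨h.meetSemidistributive, h.dual.meetSemidistributive⟩⟩
    obtain ⟨row, h1, h2⟩ := h.exists_row
    exact ⟨⟨row, h1, h2⟩, fun σ σ' => (h2 σ).trans (h2 σ').symm⟩
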